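/- Let $K$ be an infinite field and let $n\geq 1$ and $r$ be natural numbers. The extended affine Weyl group $\widehat\Sigma_r=\Sigma_r\ltimes\mathbb Z^r$ acts on the right on $\mathbb Z^r$, with $\sigma\in\Sigma_r$ acting by place permutation, $\underline i\sigma=(i_{\sigma(1)},\dots,i_{\sigma(r)})$, and $\varepsilon\in\mathbb Z^r$ acting by $\underline i\mapsto \underline i+n\varepsilon$; it acts diagonally on $\mathbb Z^r\times\mathbb Z^r$. Write $\sim$ for "lies in the same $\widehat\Sigma_r$-orbit". The affine Schur algebra $\widetilde S(n,r)$ is the $K$-algebra with basis the elements $\xi_{\underline i,\underline j}$ indexed by the $\widehat\Sigma_r$-orbits of pairs $(\underline i,\underline j)\in\mathbb Z^r\times\mathbb Z^r$ (so $\xi_{\underline i,\underline j}=\xi_{\underline k,\underline l}$ if and only if $(\underline i,\underline j)\sim(\underline k,\underline l)$) and with multiplication $$\xi_{\underline i,\underline j}\,\xi_{\underline k,\underline l}=\sum_{(\underline p,\underline q)}\#\{\underline s\in\mathbb Z^r\mid(\underline i,\underline j)\sim(\underline p,\underline s),\ (\underline s,\underline q)\sim(\underline k,\underline l)\}\;\xi_{\underline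 p,\underline q},$$ where $(\underline p,\underline q)$ runs over representatives of the orbits. Let $\underline i\in\{1,\dots,n\}^r$, let $\widetilde S(\underline i)=\xi_{\underline i,\underline i}\widetilde S(n,r)\xi_{\underline i,\underline i}$, an algebra with identity $\xi_{\underline i,\underline i}$, and let $B_{\underline i}$ be the $K$-linear span of the elements $\xi_{\underline i,\underline i+n\varepsilon}$, $\varepsilon\in\mathbb Z^r$. Then $B_{\underline i}$ is a maximal commutative subalgebra of $\widetilde S(\underline i)$: it is a commutative subalgebra, and every commutative subalgebra of $\widetilde S(\underline i)$ that contains $B_{\underline i}$ equals $B_{\underline i}$. -/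

import Mathlib

noncomputable section

namespace AffineSchur

/-- The right action on `r`-tuples of integers of an element `σ ε` (with `σ` a permutation and
`ε` in `ℤ ^ r`) of the extended affine Weyl group `Σ_r ⋉ ℤ ^ r`, namely `i ↦ i σ + n ε`, where
`σ` acts by place permutation. Every element of the group is of this form. -/
def act (n : ℕ) {r : ℕ} (σ : Equiv.Perm (Fin r)) (ε : Fin r → ℤ) (i : Fin r → ℤ) : Fin r → ℤ :=
  fun k => i (σ k) + (n : ℤ) * ε k

/-- Two pairs of tuples lie in the same orbit of the diagonal action. -/
def Rel (n : ℕ) {r : ℕ} (x y : (Fin r → ℤ) × (Fin r → ℤ)) : Prop :=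
  ∃ (σ : Equiv.Perm (Fin r)) (ε : Fin r → ℤ), act n σ ε x.1 = y.1 ∧ act n σ ε x.2 = y.2

theorem act_act (n : ℕ) {r : ℕ} (σ τ : Equiv.Perm (Fin r)) (ε η i : Fin r → ℤ) :
    act n τ η (act n σ ε i) = act n (σ * τ) (fun k => ε (τ k) + η k) i := by
  funext k
  simp only [act, Equiv.Perm.coe_mul, Function.comp_apply]
  ring

theorem act_one (n : ℕ) {r : ℕ} (i : Fin r → ℤ) : act n 1 0 i = i := by
  funext k
  simp [act]

theorem act_inv_act (n : ℕ) {r : ℕ} (σ : Equiv.Perm (Fin r)) (ε i : Fin r → ℤ) :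
    act n σ⁻¹ (fun k => - ε (σ⁻¹ k)) (act n σ ε i) = i := by
  funext k
  simp [act]

theorem act_act_inv (n : ℕ) {r : ℕ} (σ : Equiv.Perm (Fin r)) (ε i : Fin r → ℤ) :
    act n σ ε (act n σ⁻¹ (fun k => - ε (σ⁻¹ k)) i) = i := by
  funext k
  simp [act]

/-- The orbit equivalence relation on pairs of tuples. -/
def orbitSetoid (n r : ℕ) : Setoid ((Fin r → ℤ) × (Fin r → ℤ)) where
  r := Rel n
  iseqv :=
    { refl := fun x => ⟨1, 0, act_one n _, act_one n _⟩
      symm := by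
        rintro x y ⟨σ, ε, h1, h2⟩
        exact ⟨σ⁻¹, fun k => - ε (σ⁻¹ k), by rw [← h1, act_inv_act], by rw [← h2, act_inv_act]⟩
      trans := by
        rintro x y z ⟨σ, ε, h1, h2⟩ ⟨τ, η, h3, h4⟩
        exact ⟨σ * τ, fun k => ε (τ k) + η k, by rw [← act_act, h1, h3],
          by rw [← act_act, h2, h4]⟩ }

/-- The set of orbits on pairs of tuples; it indexes the basis of the affine Schur algebra. -/
def Orb (n r : ℕ) : Type := Quotient (orbitSetoid n r)

/-- The orbit of the pair `(i, j)`. -/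
def orb (n : ℕ) {r : ℕ} (i j : Fin r → ℤ) : Orb n r := Quotient.mk (orbitSetoid n r) (i, j)

theorem orb_eq_iff {n r : ℕ} {i j k l : Fin r → ℤ} :
    orb n i j = orb n k l ↔ Rel n (i, j) (k, l) :=
  ⟨fun h => Quotient.exact h, fun h => Quotient.sound h⟩

theorem exists_orb {n r : ℕ} (c : Orb n r) : ∃ i j, orb n i j = c := by
  obtain ⟨⟨i, j⟩, h⟩ := Quotient.exists_rep c
  exact ⟨i, j, h⟩

theorem orb_act (n : ℕ) {r : ℕ} (σ : Equiv.Perm (Fin r)) (ε i j : Fin r → ℤ) :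
    orb n (act n σ ε i) (act n σ ε j) = orb n i j :=
  (orb_eq_iff.2 ⟨σ, ε, rfl, rfl⟩).symm

theorem finite_right {n r : ℕ} (p : Fin r → ℤ) (a : Orb n r) : {s | orb n p s = a}.Finite := by
  obtain ⟨i, j, rfl⟩ := exists_orb a
  refine (Set.finite_range
    (fun (σ : Equiv.Perm (Fin r)) (k : Fin r) => j (σ k) + (p k - i (σ k)))).subset ?_
  intro s hs
  obtain ⟨σ, ε, h1, h2⟩ := orb_eq_iff.1 (Eq.symm hs)
  refine ⟨σ, ?_⟩
  funext k
  have h1k := congrFun h1 k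
  have h2k := congrFun h2 k
  simp only [act] at h1k h2k
  simp only
  linarith

/-- The set of `s` with `(p, s)` in the orbit `a` and `(s, q)` in the orbit `b`. -/
def middle {n r : ℕ} (a b : Orb n r) (p q : Fin r → ℤ) : Set (Fin r → ℤ) :=
  {s | orb n p s = a ∧ orb n s q = b}

theorem finite_middle {n r : ℕ} (a b : Orb n r) (p q : Fin r → ℤ) : (middle a b p q).Finite :=
  (finite_right p a).subset fun _ h => h.1

theorem ncard_middle_act {n r : ℕ} (a b : Orb n r) (σ : Equiv.Perm (Fin r))
    (ε p q : Fin r → ℤ) :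
    (middle a b (act n σ ε p) (act n σ ε q)).ncard = (middle a b p q).ncard := by
  symm
  refine Set.ncard_congr (fun s _ => act n σ ε s) ?_ ?_ ?_
  · rintro s ⟨h1, h2⟩
    exact ⟨by rw [orb_act, h1], by rw [orb_act, h2]⟩
  · intro s t _ _ h
    have h' := congrArg (act n σ⁻¹ (fun k => - ε (σ⁻¹ k))) h
    simp only [act_inv_act] at h'
    exact h'
  · rintro t ⟨h1, h2⟩
    refine ⟨act n σ⁻¹ (fun k => - ε (σ⁻¹ k)) t, ⟨?_, ?_⟩, act_act_inv n σ ε t⟩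
    · rw [← orb_act n σ ε, act_act_inv, h1]
    · rw [← orb_act n σ ε, act_act_inv, h2]

/-- The structure constant `Z(i, j, k, l, p, q)`, depending only on the orbits `a`, `b`, `c` of
`(i, j)`, `(k, l)` and `(p, q)`: the number of `s` such that `(i, j)` is equivalent to `(p, s)`
and `(s, q)` is equivalent to `(k, l)`. -/
def Z {n r : ℕ} (a b c : Orb n r) : ℕ :=
  Quotient.lift (s := orbitSetoid n r) (fun x => (middle a b x.1 x.2).ncard)
    (by
      rintro ⟨p, q⟩ ⟨p', q'⟩ ⟨σ, ε, h1, h2⟩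
      simp only at h1 h2 ⊢
      rw [← h1, ← h2, ncard_middle_act]) c

theorem Z_orb {n r : ℕ} (a b : Orb n r) (p q : Fin r → ℤ) :
    Z a b (orb n p q) = {s | orb n p s = a ∧ orb n s q = b}.ncard := rfl

theorem finite_Z {n r : ℕ} (a b : Orb n r) : {c | Z a b c ≠ 0}.Finite := by
  obtain ⟨i, j, rfl⟩ := exists_orb a
  refine (((finite_right i (orb n i j)).biUnion
    fun s _ => finite_right s b).image (fun q => orb n i q)).subset ?_
  intro c hc
  obtain ⟨p, q, rfl⟩ := exists_orb c
  obtain ⟨s, h1, h2⟩ := Set.nonempty_of_ncard_ne_zero hc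
  obtain ⟨σ, ε, h3, h4⟩ := orb_eq_iff.1 h1
  simp only at h3 h4
  refine ⟨act n σ ε q, ?_, ?_⟩
  · refine Set.mem_biUnion (x := j) rfl ?_
    rw [← h4, Set.mem_ofPred_eq, orb_act, h2]
  · simp only
    rw [← h3, orb_act]

end AffineSchur

/-- The affine Schur algebra over `K` with parameters `n`, `r`: the `K`-vector space with
basis the orbits of the extended affine Weyl group on pairs of `r`-tuples of integers.
The multiplication is defined below. -/
def AffineSchurAlgebra (K : Type*) [Field K] (n r : ℕ) : Type _ := AffineSchur.Orb n r →₀ K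

namespace AffineSchur

instance instAddCommGroup (K : Type*) [Field K] (n r : ℕ) :
    AddCommGroup (AffineSchurAlgebra K n r) :=
  inferInstanceAs (AddCommGroup (Orb n r →₀ K))

instance instModule (K : Type*) [Field K] (n r : ℕ) : Module K (AffineSchurAlgebra K n r) :=
  inferInstanceAs (Module K (Orb n r →₀ K))

/-- The basis of the affine Schur algebra. -/
def basis (K : Type*) [Field K] (n r : ℕ) :
    Module.Basis (Orb n r) K (AffineSchurAlgebra K n r) :=
  Module.Basis.ofRepr (LinearEquiv.refl K (Orb n r →₀ K))

/-- The basis element `ξ_{i, j}`. -/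
def xi (K : Type*) [Field K] (n : ℕ) {r : ℕ} (i j : Fin r → ℤ) : AffineSchurAlgebra K n r :=
  basis K n r (orb n i j)

/-- The product of two basis elements: `∑_c Z(a, b, c) ξ_c`. -/
def basisMul (K : Type*) [Field K] {n r : ℕ} (a b : Orb n r) : AffineSchurAlgebra K n r :=
  ∑ c ∈ (finite_Z a b).toFinset, (Z a b c : K) • basis K n r c

/-- The bilinear extension of the product of basis elements. -/
def mulBilin (K : Type*) [Field K] (n r : ℕ) :
    AffineSchurAlgebra K n r →ₗ[K] AffineSchurAlgebra K n r →ₗ[K] AffineSchurAlgebra K n r :=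
  (basis K n r).constr K fun a => (basis K n r).constr K fun b => basisMul K a b

instance instMul (K : Type*) [Field K] (n r : ℕ) : Mul (AffineSchurAlgebra K n r) :=
  ⟨fun x y => mulBilin K n r x y⟩

open Classical in
/-- The identity element: the sum of the `ξ_{i, i}` over the tuples `i` with entries in
`{1, …, n}` up to permutation. -/
instance instOne (K : Type*) [Field K] (n r : ℕ) : One (AffineSchurAlgebra K n r) :=
  ⟨∑ c ∈ (Fintype.piFinset fun _ : Fin r => Finset.Icc (1 : ℤ) n).image (fun i => orb n i i),
    basis K n r c⟩

theorem mul_def {K : Type*} [Field K] {n r : ℕ} (x y : AffineSchurAlgebra K n r) :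
    x * y = mulBilin K n r x y := rfl

theorem basis_mul_basis {K : Type*} [Field K] {n r : ℕ} (a b : Orb n r) :
    basis K n r a * basis K n r b = basisMul K a b := by
  simp [mul_def, mulBilin, Module.Basis.constr_basis]

theorem repr_basisMul {K : Type*} [Field K] {n r : ℕ} (a b c : Orb n r) :
    (basis K n r).repr (basisMul K a b) c = (Z a b c : K) := by
  classical
  simp only [basisMul, map_sum, map_smul, Module.Basis.repr_self, Finsupp.coe_finsetSum,
    Finset.sum_apply, Finsupp.smul_apply, Finsupp.single_apply, smul_eq_mul, mul_ite, mul_one,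
    mul_zero, Finset.sum_ite_eq', Set.Finite.mem_toFinset, Set.mem_ofPred_eq]
  split_ifs with h
  · rfl
  · rw [not_not.1 h, Nat.cast_zero]

/-- The coefficients of an element, as a row-finite matrix indexed by tuples. -/
def row {K : Type*} [Field K] {n r : ℕ} (p : Fin r → ℤ) :
    AffineSchurAlgebra K n r →ₗ[K] ((Fin r → ℤ) →₀ K) where
  toFun x := Finsupp.ofSupportFinite (fun s => (basis K n r).repr x (orb n p s)) (by
    refine (((basis K n r).repr x).support.finite_toSet.biUnion
      fun a _ => finite_right p a).subset ?_
    intro s hs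
    refine Set.mem_biUnion (x := orb n p s) ?_ rfl
    simpa using hs)
  map_add' x y := by
    ext s
    simp [Finsupp.ofSupportFinite_coe]
  map_smul' t x := by
    ext s
    simp [Finsupp.ofSupportFinite_coe]

theorem row_apply {K : Type*} [Field K] {n r : ℕ} (p s : Fin r → ℤ)
    (x : AffineSchurAlgebra K n r) : row p x s = (basis K n r).repr x (orb n p s) := rfl

theorem row_ext {K : Type*} [Field K] {n r : ℕ} {x y : AffineSchurAlgebra K n r}
    (h : ∀ p, row p x = row p y) : x = y := by
  apply (basis K n r).repr.injective
  ext c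
  obtain ⟨p, q, rfl⟩ := exists_orb c
  exact DFunLike.congr_fun (h p) q

/-- An element of the algebra acting on row vectors. -/
def rho {K : Type*} [Field K] {n r : ℕ} :
    AffineSchurAlgebra K n r →ₗ[K] ((Fin r → ℤ) →₀ K) →ₗ[K] ((Fin r → ℤ) →₀ K) where
  toFun y := Finsupp.linearCombination K (fun s => row s y)
  map_add' x y := by
    ext s : 1
    ext
    simp
  map_smul' t x := by
    ext s : 1
    ext
    simp

theorem rho_single {K : Type*} [Field K] {n r : ℕ} (y : AffineSchurAlgebra K n r)
    (p : Fin r → ℤ) : rho y (Finsupp.single p 1) = row p y := by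
  simp [rho]

theorem rho_apply {K : Type*} [Field K] {n r : ℕ} (y : AffineSchurAlgebra K n r)
    (f : (Fin r → ℤ) →₀ K) (q : Fin r → ℤ) :
    rho y f q = ∑ s ∈ f.support, f s * (basis K n r).repr y (orb n s q) := by
  simp [rho, Finsupp.linearCombination_apply, Finsupp.sum, row_apply]

theorem row_mul {K : Type*} [Field K] {n r : ℕ} (x y : AffineSchurAlgebra K n r)
    (p : Fin r → ℤ) : row p (x * y) = rho y (row p x) := by
  classical
  have key : (mulBilin K n r).compr₂ (row p) =
      (LinearMap.flip (rho (K := K) (n := n) (r := r))).comp (row p) := by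
    refine (basis K n r).ext fun a => (basis K n r).ext fun b => ?_
    ext q
    simp only [LinearMap.compr₂_apply, LinearMap.comp_apply, LinearMap.flip_apply]
    rw [← mul_def, basis_mul_basis, row_apply, repr_basisMul, Z_orb, rho_apply]
    have hsub : {s | orb n p s = a ∧ orb n s q = b} =
        (((row p (basis K n r a)).support.filter fun s => orb n s q = b : Finset _) :
          Set (Fin r → ℤ)) := by
      ext s
      simp only [Set.mem_ofPred_eq, Finset.coe_filter, Finsupp.mem_support_iff, row_apply,
        Module.Basis.repr_self, Finsupp.single_apply, ne_eq, ite_eq_right_iff, one_ne_zero,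
        imp_false, not_not]
      tauto
    rw [hsub, Set.ncard_coe_finset, Finset.card_filter, Nat.cast_sum]
    refine Finset.sum_congr rfl fun s hs => ?_
    rw [Finsupp.mem_support_iff, row_apply, Module.Basis.repr_self, Finsupp.single_apply] at hs
    rw [row_apply, Module.Basis.repr_self, Module.Basis.repr_self, Finsupp.single_apply,
      Finsupp.single_apply]
    have ha : a = orb n p s := by
      by_contra h
      simp [h] at hs
    rw [if_pos ha, one_mul]
    by_cases h : orb n s q = b
    · simp [h]
    · simp [h, Ne.symm h]
  exact LinearMap.congr_fun (LinearMap.congr_fun key x) y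

theorem rho_mul {K : Type*} [Field K] {n r : ℕ} (x y : AffineSchurAlgebra K n r)
    (f : (Fin r → ℤ) →₀ K) : rho (x * y) f = rho y (rho x f) := by
  have : rho (x * y) = (rho y).comp (rho x) := by
    ext s : 1
    ext1
    simp [rho_single, row_mul]
  rw [this, LinearMap.comp_apply]

theorem exists_act_mem_Icc (n : ℕ) [NeZero n] {r : ℕ} (p : Fin r → ℤ) :
    ∃ ε : Fin r → ℤ, ∀ k, act n 1 ε p k ∈ Finset.Icc (1 : ℤ) n := by
  have hn : (0 : ℤ) < n := by exact_mod_cast Nat.pos_of_ne_zero (NeZero.ne n)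
  refine ⟨fun k => - ((p k - 1) / n), fun k => ?_⟩
  have h1 := Int.emod_nonneg (p k - 1) hn.ne'
  have h2 := Int.emod_lt_of_pos (p k - 1) hn
  have h3 := Int.mul_ediv_add_emod (p k - 1) n
  rw [Finset.mem_Icc]
  simp only [act, Equiv.Perm.coe_one, id_eq, mul_neg]
  constructor <;> linarith

theorem row_one {K : Type*} [Field K] {n r : ℕ} [NeZero n] (p : Fin r → ℤ) :
    row p (1 : AffineSchurAlgebra K n r) = Finsupp.single p 1 := by
  classical
  ext q
  have h1 : (1 : AffineSchurAlgebra K n r) =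
      ∑ c ∈ (Fintype.piFinset fun _ : Fin r => Finset.Icc (1 : ℤ) n).image (fun i => orb n i i),
        basis K n r c := by
    simp only [One.one, OfNat.ofNat]
  rw [row_apply, h1]
  simp only [map_sum, Module.Basis.repr_self, Finsupp.coe_finsetSum, Finset.sum_apply,
    Finsupp.single_apply, Finset.sum_ite_eq']
  congr 1
  rw [eq_iff_iff]
  constructor
  · intro h
    obtain ⟨i, _, hi⟩ := Finset.mem_image.1 h
    obtain ⟨σ, ε, h2, h3⟩ := orb_eq_iff.1 hi
    exact h2.symm.trans h3
  · rintro rfl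
    obtain ⟨ε, hε⟩ := exists_act_mem_Icc n p
    exact Finset.mem_image.2 ⟨act n 1 ε p, Fintype.mem_piFinset.2 hε, orb_act n 1 ε p p⟩

theorem rho_one {K : Type*} [Field K] {n r : ℕ} [NeZero n] (f : (Fin r → ℤ) →₀ K) :
    rho (1 : AffineSchurAlgebra K n r) f = f := by
  have : rho (1 : AffineSchurAlgebra K n r) = LinearMap.id := by
    ext s : 1
    ext1
    simp [rho_single, row_one]
  rw [this, LinearMap.id_apply]

instance instRing (K : Type*) [Field K] (n r : ℕ) [NeZero n] : Ring (AffineSchurAlgebra K n r) :=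
  { instAddCommGroup K n r, instMul K n r, instOne K n r with
    left_distrib := fun x y z => by simp [mul_def]
    right_distrib := fun x y z => by simp [mul_def]
    zero_mul := fun x => by simp [mul_def]
    mul_zero := fun x => by simp [mul_def]
    mul_assoc := fun x y z => row_ext fun p => by simp only [row_mul, rho_mul]
    one_mul := fun x => row_ext fun p => by rw [row_mul, row_one, rho_single]
    mul_one := fun x => row_ext fun p => by rw [row_mul, rho_one] }

instance instAlgebra (K : Type*) [Field K] (n r : ℕ) [NeZero n] :
    Algebra K (AffineSchurAlgebra K n r) :=
  Algebra.ofModule (fun t x y => by simp [mul_def]) (fun t x y => by simp [mul_def])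

/-- The product formula: the coefficient of `ξ_{i, j} ξ_{k, l}` at `ξ_{p, q}`. -/
theorem repr_xi_mul_xi {K : Type*} [Field K] {n r : ℕ} [NeZero n] (i j k l p q : Fin r → ℤ) :
    (basis K n r).repr (xi K n i j * xi K n k l) (orb n p q) =
      ({s | Rel n (i, j) (p, s) ∧ Rel n (s, q) (k, l)}.ncard : K) := by
  have h : {s | Rel n (i, j) (p, s) ∧ Rel n (s, q) (k, l)} =
      {s | orb n p s = orb n i j ∧ orb n s q = orb n k l} := by
    ext s
    rw [Set.mem_ofPred_eq, Set.mem_ofPred_eq, eq_comm, orb_eq_iff, orb_eq_iff]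
  rw [h, ← Z_orb, ← repr_basisMul, ← basis_mul_basis]
  rfl

theorem row_xi_self {K : Type*} [Field K] {n r : ℕ} (i p : Fin r → ℤ)
    [Decidable (orb n i i = orb n p p)] :
    row p (xi K n i i) = if orb n i i = orb n p p then Finsupp.single p 1 else 0 := by
  classical
  ext q
  rw [row_apply, xi, Module.Basis.repr_self, Finsupp.single_apply]
  by_cases hpq : p = q
  · subst hpq
    split_ifs <;> simp
  · have hne : orb n i i ≠ orb n p q := fun h => by
      obtain ⟨σ, ε, h2, h3⟩ := orb_eq_iff.1 h
      exact hpq (h2.symm.trans h3)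
    rw [if_neg hne]
    split_ifs <;> simp [hpq]

theorem xi_self_mul_xi {K : Type*} [Field K] {n r : ℕ} [NeZero n] (i j : Fin r → ℤ) :
    xi K n i i * xi K n i j = xi K n i j := by
  classical
  refine row_ext fun p => ?_
  rw [row_mul, row_xi_self]
  split_ifs with h
  · rw [rho_single]
  · rw [map_zero]
    ext q
    rw [row_apply, xi, Module.Basis.repr_self, Finsupp.single_apply, if_neg, Finsupp.zero_apply]
    intro hq
    obtain ⟨σ, ε, h2, _⟩ := orb_eq_iff.1 hq
    exact h (orb_eq_iff.2 ⟨σ, ε, h2, h2⟩)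

theorem xi_mul_xi_self {K : Type*} [Field K] {n r : ℕ} [NeZero n] (i j : Fin r → ℤ) :
    xi K n i j * xi K n j j = xi K n i j := by
  classical
  refine row_ext fun p => ?_
  rw [row_mul]
  ext q
  have hsum : ∀ s, (basis K n r).repr (xi K n j j) (orb n s q) =
      if s = q ∧ orb n j j = orb n q q then 1 else 0 := by
    intro s
    rw [← row_apply, row_xi_self]
    by_cases hs : s = q
    · subst hs
      split_ifs <;> simp_all
    · split_ifs <;> simp_all
  rw [rho_apply]
  simp only [hsum, row_apply]
  have hrow : (row p (xi K n i j)) q = (basis K n r).repr (xi K n i j) (orb n p q) := rfl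
  by_cases hq : orb n i j = orb n p q
  · have hj : orb n j j = orb n q q := by
      obtain ⟨σ, ε, _, h3⟩ := orb_eq_iff.1 hq
      exact orb_eq_iff.2 ⟨σ, ε, h3, h3⟩
    have hmem : q ∈ (row p (xi K n i j)).support := by
      rw [Finsupp.mem_support_iff, hrow, xi, Module.Basis.repr_self, Finsupp.single_apply,
        if_pos hq]
      exact one_ne_zero
    rw [Finset.sum_eq_single_of_mem q hmem]
    · simp [hj]
    · intro s _ hs
      simp [hs]
  · have h0 : (basis K n r).repr (xi K n i j) (orb n p q) = 0 := by
      rw [xi, Module.Basis.repr_self, Finsupp.single_apply, if_neg hq]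
    rw [h0]
    refine Finset.sum_eq_zero fun s _ => ?_
    by_cases hs : s = q
    · subst hs
      simp [h0]
    · simp [hs]

theorem isIdempotentElem_xi (K : Type*) [Field K] (n : ℕ) {r : ℕ} [NeZero n] (i : Fin r → ℤ) :
    IsIdempotentElem (xi K n i i) :=
  xi_self_mul_xi i i

end AffineSchur

section Corner

variable {K A : Type*} [Field K] [Ring A] [Algebra K A] {e : A}

/-- The `K`-vector space structure on the corner ring `e A e` of a `K`-algebra `A`, given by
scalar multiplication in `A`. -/
instance IsIdempotentElem.Corner.instModuleOfAlgebra (he : IsIdempotentElem e) :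
    Module K he.Corner where
  smul t x := ⟨t • x.1, by
    obtain ⟨a, ha⟩ := x.2
    exact ⟨t • a, by simp only [mul_smul_comm, smul_mul_assoc]; exact congrArg (t • ·) ha⟩⟩
  one_smul x := Subtype.ext (one_smul K x.1)
  mul_smul s t x := Subtype.ext (mul_smul s t x.1)
  smul_zero t := Subtype.ext (smul_zero t)
  smul_add t x y := Subtype.ext (smul_add t x.1 y.1)
  add_smul s t x := Subtype.ext (add_smul s t x.1)
  zero_smul x := Subtype.ext (zero_smul K x.1)

/-- The corner ring `e A e` of a `K`-algebra `A` is a `K`-algebra with identity `e`. -/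
instance IsIdempotentElem.Corner.instAlgebraOfAlgebra (he : IsIdempotentElem e) :
    Algebra K he.Corner :=
  Algebra.ofModule (fun t x y => Subtype.ext (smul_mul_assoc t x.1 y.1))
    (fun t x y => Subtype.ext (mul_smul_comm t x.1 y.1))

end Corner

namespace AffineSchur

/-- The centralizer algebra `ξ_{i, i} S ξ_{i, i}` of the affine Schur algebra `S`. -/
abbrev CentralizerAlgebra (K : Type*) [Field K] (n : ℕ) {r : ℕ} [NeZero n] (i : Fin r → ℤ) :
    Type _ :=
  (isIdempotentElem_xi K n i).Corner

theorem xi_self_shift (K : Type*) [Field K] (n : ℕ) {r : ℕ} (i ε : Fin r → ℤ) :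
    xi K n (fun k => i k + (n : ℤ) * ε k) (fun k => i k + (n : ℤ) * ε k) = xi K n i i :=
  congrArg (basis K n r) (orb_act n 1 ε i i)

/-- The element `ξ_{i, i + n ε}` of the centralizer algebra. -/
def xiShift (K : Type*) [Field K] (n : ℕ) {r : ℕ} [NeZero n] (i ε : Fin r → ℤ) :
    CentralizerAlgebra K n i :=
  ⟨xi K n i (fun k => i k + (n : ℤ) * ε k),
    (Subsemigroup.mem_corner_iff (isIdempotentElem_xi K n i)).2
      ⟨xi_self_mul_xi _ _, by
        rw [← xi_self_shift K n i ε]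
        exact xi_mul_xi_self _ _⟩⟩

/-- The linear span `B_i` of the elements `ξ_{i, i + n ε}`, with `ε` in `ℤ ^ r`. -/
def B (K : Type*) [Field K] (n : ℕ) {r : ℕ} [NeZero n] (i : Fin r → ℤ) :
    Submodule K (CentralizerAlgebra K n i) :=
  Submodule.span K (Set.range (xiShift K n i))

end AffineSchur

end

namespace AffineSchur

variable {K : Type*} [Field K] {n r : ℕ}

/-! An element of the algebra is a row-finite matrix on `ℤ ^ r × ℤ ^ r`, invariant under the
extended affine Weyl group; `row p x q` is its `(p, q)` entry. Inside the corner, `B` consists of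
the matrices supported on pairs with `p ≡ q` modulo `n` (`mem_B_iff`). These commute because
translation invariance makes their product a convolution over `n ℤ ^ r` (`IsDiagonal.mul_comm`).

Maximality holds because `B` contains its own centralizer. For a residue class `a`, let `e(p)`
indicate the places where `p ≡ a`. The element `ξ_{i, i + n e(i)}` acts as the injective map `p ↦ p
+ n e(p)`, so if `x` commutes with it, a nonzero entry at `(p, q)` recurs at `(p, q + n (e(q) -
e(p)))` (`row_eq_of_commute`). If `p` and `q` differ modulo `n` at a place `k`, taking `a = p k`
gives a nonzero shift; iterating it contradicts row-finiteness (`isDiagonal_of_commute`). -/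

theorem row_mul_apply [NeZero n] (x y : AffineSchurAlgebra K n r) (p q : Fin r → ℤ) :
    row p (x * y) q = ∑ s ∈ (row p x).support, row p x s * row s y q := by
  rw [row_mul, rho_apply]
  rfl

theorem row_mul_of_row_eq_single [NeZero n] {x y : AffineSchurAlgebra K n r} {p s : Fin r → ℤ}
    (h : row p x = Finsupp.single s 1) : row p (x * y) = row s y := by
  rw [row_mul, h, rho_single]

theorem row_add_mul (x : AffineSchurAlgebra K n r) (ε p q : Fin r → ℤ) :
    row (fun k => p k + n * ε k) x (fun k => q k + n * ε k) = row p x q := by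
  rw [row_apply, row_apply]
  exact congrArg _ (orb_act n 1 ε p q)

/-! ### Diagonal matrices and their commutativity -/

/-- An element whose coefficients vanish off the pairs of tuples that are congruent modulo `n`. -/
def IsDiagonal (x : AffineSchurAlgebra K n r) : Prop :=
  ∀ p q, row p x q ≠ 0 → ∃ ε : Fin r → ℤ, q = fun k => p k + n * ε k

theorem IsDiagonal.mul [NeZero n] {x y : AffineSchurAlgebra K n r} (hx : IsDiagonal x)
    (hy : IsDiagonal y) : IsDiagonal (x * y) := by
  intro p q h
  rw [row_mul_apply] at h
  obtain ⟨s, -, hs⟩ := Finset.exists_ne_zero_of_sum_ne_zero h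
  obtain ⟨ε, rfl⟩ := hx p s (left_ne_zero_of_mul hs)
  obtain ⟨η, rfl⟩ := hy _ q (right_ne_zero_of_mul hs)
  exact ⟨fun k => ε k + η k, by funext k; ring⟩

/-- Diagonal elements commute. -/
theorem IsDiagonal.mul_comm [NeZero n] {x y : AffineSchurAlgebra K n r} (hx : IsDiagonal x)
    (hy : IsDiagonal y) : x * y = y * x := by
  refine row_ext fun p => Finsupp.ext fun q => ?_
  rw [row_mul_apply, row_mul_apply]
  -- If `s = p + nε` and `q = s + nη`, then `p + q - s = p + nη`: the reflection swaps the two steps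
  -- from `p` to `q`, and translation invariance preserves both entries.
  have reflect {x y : AffineSchurAlgebra K n r} (hx : IsDiagonal x) (hy : IsDiagonal y)
      {s : Fin r → ℤ} (h : row p x s * row s y q ≠ 0) :
      row (fun k => p k + q k - s k) x q = row p x s ∧
        row p y (fun k => p k + q k - s k) = row s y q := by
    obtain ⟨ε, rfl⟩ := hx p s (left_ne_zero_of_mul h)
    obtain ⟨η, rfl⟩ := hy _ q (right_ne_zero_of_mul h)
    constructor
    · refine Eq.trans ?_ (row_add_mul x η p (fun k => p k + n * ε k))
      congr 3
      funext k
      ring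
    · rw [← row_add_mul y ε]
      congr 1
      funext k
      ring
  refine Finset.sum_bij_ne_zero (fun s _ _ k => p k + q k - s k) ?_ ?_ ?_ ?_
  · intro s _ h
    rw [Finsupp.mem_support_iff, (reflect hx hy h).2]
    exact right_ne_zero_of_mul h
  · intro s _ _ t _ _ h
    funext k
    simpa using congrFun h k
  · intro s _ h
    obtain ⟨h1, h2⟩ := reflect hy hx h
    have hs : (fun k => p k + q k - (p k + q k - s k)) = s := by
      funext k
      ring
    refine ⟨fun k => p k + q k - s k, ?_, ?_, hs⟩
    · rw [Finsupp.mem_support_iff, h2]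
      exact right_ne_zero_of_mul h
    · rw [h1, h2, _root_.mul_comm]
      exact h
  · intro s _ h
    rw [(reflect hx hy h).1, (reflect hx hy h).2, _root_.mul_comm]

/-! ### Support of elements of the corner -/

/-- Left multiplication by `ξ_{i, i}` kills every row whose index lies outside the orbit of `i`. -/
theorem orb_self_of_row_ne_zero_left [NeZero n] {i : Fin r → ℤ} {x : AffineSchurAlgebra K n r}
    (hx : xi K n i i * x = x) {p q : Fin r → ℤ} (h : row p x q ≠ 0) :
    orb n i i = orb n p p := by
  classical
  by_contra hp
  rw [← hx, row_mul, row_xi_self, if_neg hp, map_zero] at h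
  exact h rfl

theorem orb_self_of_row_ne_zero_right [NeZero n] {i : Fin r → ℤ} {x : AffineSchurAlgebra K n r}
    (hx : x * xi K n i i = x) {p q : Fin r → ℤ} (h : row p x q ≠ 0) :
    orb n i i = orb n q q := by
  classical
  rw [← hx, row_mul_apply] at h
  obtain ⟨s, -, hs⟩ := Finset.exists_ne_zero_of_sum_ne_zero h
  have h2 := right_ne_zero_of_mul hs
  rw [row_xi_self] at h2
  split_ifs at h2 with hi
  · rw [Finsupp.single_apply_ne_zero] at h2
    rw [hi, h2.1]
  · exact absurd rfl h2

/-! ### Elements commuting with the residue shifts -/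

/-- The indicator of the places at which `p` is congruent to `a` modulo `n`. -/
def residueIndicator (n : ℕ) (a : ℤ) (p : Fin r → ℤ) : Fin r → ℤ :=
  fun k => if (n : ℤ) ∣ p k - a then 1 else 0

theorem residueIndicator_act (a : ℤ) (σ : Equiv.Perm (Fin r)) (ε p : Fin r → ℤ) :
    residueIndicator n a (act n σ ε p) = fun k => residueIndicator n a p (σ k) := by
  funext k
  simp only [residueIndicator, act, add_sub_right_comm, dvd_add_left (dvd_mul_right _ _)]

theorem residueIndicator_add_mul (a : ℤ) (ε p : Fin r → ℤ) :
    residueIndicator n a (fun k => p k + n * ε k) = residueIndicator n a p :=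
  residueIndicator_act a 1 ε p

/-- The shift `p ↦ p + n e(p)` is equivariant, so the column index is determined by the row index.
For a general `ε` in place of `e(i)`, the stabilizer of `i` could move the column and produce
several entries in one row. -/
theorem row_xi_residueIndicator (a : ℤ) {i p : Fin r → ℤ} (h : orb n i i = orb n p p) :
    row p (xi K n i (fun k => i k + n * residueIndicator n a i k)) =
      Finsupp.single (fun k => p k + n * residueIndicator n a p k) 1 := by
  classical
  have shift_act (σ : Equiv.Perm (Fin r)) (ε : Fin r → ℤ) :
      act n σ ε (fun k => i k + n * residueIndicator n a i k) =
        fun k => act n σ ε i k + n * residueIndicator n a (act n σ ε i) k := by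
    rw [residueIndicator_act]
    funext k
    simp only [act]
    ring
  ext q
  rw [row_apply, xi, Module.Basis.repr_self, Finsupp.single_apply, Finsupp.single_apply]
  congr 1
  rw [eq_iff_iff]
  constructor
  · intro hq
    obtain ⟨σ, ε, h1, h2⟩ := orb_eq_iff.1 hq
    simp only at h1 h2
    rw [← h1, ← h2, shift_act]
  · rintro rfl
    obtain ⟨σ, ε, h1, -⟩ := orb_eq_iff.1 h
    simp only at h1
    exact orb_eq_iff.2 ⟨σ, ε, h1, by rw [← h1]; exact shift_act σ ε⟩

/-- If `x` commutes with the elements `ξ_{i, i + n ε}`, its coefficients are periodic in the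
direction in which the residues of the two tuples differ. -/
theorem row_eq_of_commute [NeZero n] {i : Fin r → ℤ} {x : AffineSchurAlgebra K n r}
    (hl : xi K n i i * x = x) (hr : x * xi K n i i = x) (a : ℤ)
    (hc : x * xi K n i (fun k => i k + n * residueIndicator n a i k) =
      xi K n i (fun k => i k + n * residueIndicator n a i k) * x)
    {p q : Fin r → ℤ} (h : row p x q ≠ 0) :
    row p x (fun k => q k + n * (residueIndicator n a q k - residueIndicator n a p k)) =
      row p x q := by
  classical
  have hp := orb_self_of_row_ne_zero_left hl h
  have hq := orb_self_of_row_ne_zero_right hr h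
  -- Compare entries at `(p, q + n e(q))`. On the left only the middle index `q` contributes; on the
  -- right only `p + n e(p)` does, and translating back by `n e(p)` gives the claim.
  have h1 := congrArg (fun z => row p z (fun k => q k + n * residueIndicator n a q k)) hc
  rw [row_mul_of_row_eq_single (row_xi_residueIndicator a hp), row_mul_apply,
    Finset.sum_eq_single_of_mem q (Finsupp.mem_support_iff.2 h),
    row_xi_residueIndicator a hq, Finsupp.single_eq_same, mul_one] at h1
  · rw [h1, ← row_add_mul x (residueIndicator n a p)]
    congr 1
    funext k
    ring
  · intro s hs hsq
    rw [row_xi_residueIndicator a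
      (orb_self_of_row_ne_zero_right hr (Finsupp.mem_support_iff.1 hs)),
      Finsupp.single_eq_of_ne, mul_zero]
    intro heq
    apply hsq
    -- The shift preserves residues, so equal images have equal shifts; hence it is injective.
    have hres := congrArg (residueIndicator n a) heq
    rw [residueIndicator_add_mul, residueIndicator_add_mul] at hres
    funext k
    have := congrFun heq k
    rw [hres] at this
    exact (add_right_cancel this).symm

theorem isDiagonal_of_commute [NeZero n] {i : Fin r → ℤ} {x : AffineSchurAlgebra K n r}
    (hl : xi K n i i * x = x) (hr : x * xi K n i i = x)
    (hc : ∀ ε : Fin r → ℤ, x * xi K n i (fun k => i k + n * ε k) =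
      xi K n i (fun k => i k + n * ε k) * x) : IsDiagonal x := by
  intro p q h
  by_contra hpq
  obtain ⟨k, hk⟩ : ∃ k, ¬ (n : ℤ) ∣ q k - p k := by
    by_contra! hall
    choose ε hε using hall
    exact hpq ⟨ε, by funext k; linarith [hε k]⟩
  -- With `a = p k`, the indicator at `k` is 1 for `p` and 0 for `q`, which forces `δ k = -1`.
  set δ : Fin r → ℤ := fun l => residueIndicator n (p k) q l - residueIndicator n (p k) p l
    with hδ
  have hδk : δ k = -1 := by simp [hδ, residueIndicator, hk]
  have hrow (m : ℕ) : row p x (fun l => q l + n * (m * δ l)) = row p x q := by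
    induction m with
    | zero => simp
    | succ m ih =>
      rw [← ih, ← row_eq_of_commute hl hr (p k) (hc _) (ih.trans_ne h)]
      -- The shifted column has the residues of `q`, so the next step is again by `δ`.
      rw [residueIndicator_add_mul (p k) (fun l => m * δ l) q]
      congr 1
      funext l
      push_cast
      ring
  refine Set.infinite_range_of_injective (f := fun (m : ℕ) l => q l + n * (m * δ l)) ?_
    ((row p x).support.finite_toSet.subset ?_)
  · intro m m' hm
    have hn : (n : ℤ) ≠ 0 := by exact_mod_cast NeZero.ne n
    have hk := congrFun hm k
    simp only [hδk, add_right_inj, mul_neg, mul_one, neg_inj, mul_eq_mul_left_iff, hn, or_false,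
      Nat.cast_inj] at hk
    exact hk
  · rintro _ ⟨m, rfl⟩
    exact Finsupp.mem_support_iff.2 ((hrow m).trans_ne h)

/-! ### The span `B` as the diagonal part of the corner -/

theorem isDiagonal_xi_add_mul (i ε : Fin r → ℤ) :
    IsDiagonal (xi K n i (fun k => i k + n * ε k)) := by
  classical
  intro p q h
  rw [row_apply, xi, Module.Basis.repr_self, Finsupp.single_apply] at h
  have hq : orb n i (fun k => i k + n * ε k) = orb n p q := by
    by_contra hne
    exact h (if_neg hne)
  obtain ⟨σ, η, h1, h2⟩ := orb_eq_iff.1 hq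
  refine ⟨fun k => ε (σ k), ?_⟩
  simp only at h1 h2
  rw [← h1, ← h2]
  funext k
  simp only [act]
  ring

variable [NeZero n] {i : Fin r → ℤ}

theorem corner_left (x : CentralizerAlgebra K n i) : xi K n i i * x.1 = x.1 :=
  ((Subsemigroup.mem_corner_iff (isIdempotentElem_xi K n i)).1 x.2).1

theorem corner_right (x : CentralizerAlgebra K n i) : x.1 * xi K n i i = x.1 :=
  ((Subsemigroup.mem_corner_iff (isIdempotentElem_xi K n i)).1 x.2).2

/-- The inclusion of the centralizer algebra in the affine Schur algebra. -/
def cornerVal (K : Type*) [Field K] (n : ℕ) [NeZero n] (i : Fin r → ℤ) :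
    CentralizerAlgebra K n i →ₗ[K] AffineSchurAlgebra K n r where
  toFun x := x.1
  map_add' _ _ := rfl
  map_smul' _ _ := rfl

theorem map_cornerVal_B : (B K n i).map (cornerVal K n i) =
    Submodule.span K (Set.range fun ε : Fin r → ℤ => xi K n i (fun k => i k + n * ε k)) := by
  rw [B, Submodule.map_span, ← Set.range_comp]
  rfl

/-- For the converse, each orbit in the support of a diagonal `x` contains some `(p, p + nε)`. Since
`x` lies in the corner, `p` is in the orbit of `i`, so the pair can be moved to one starting at `i`.
-/
theorem mem_B_iff (x : CentralizerAlgebra K n i) : x ∈ B K n i ↔ IsDiagonal x.1 := by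
  constructor
  · intro hx
    induction hx using Submodule.span_induction with
    | mem x h =>
      obtain ⟨ε, rfl⟩ := h
      exact isDiagonal_xi_add_mul i ε
    | zero => exact fun p q h => absurd rfl h
    | add x y _ _ hx hy =>
      intro p q h
      by_cases hxp : row p x.1 q = 0
      · refine hy p q fun hyp => h ?_
        change row p (x.1 + y.1) q = 0
        rw [map_add, Finsupp.add_apply, hxp, hyp, add_zero]
      · exact hx p q hxp
    | smul t x _ hx =>
      refine fun p q h => hx p q fun hxp => h ?_
      change row p (t • x.1) q = 0
      rw [map_smul, Finsupp.smul_apply, hxp, smul_zero]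
  · intro hx
    -- The basis expansion takes place in the ambient algebra, so membership is checked after the
    -- injective inclusion.
    suffices h : cornerVal K n i x ∈ (B K n i).map (cornerVal K n i) by
      obtain ⟨y, hy, hyx⟩ := h
      rwa [← Subtype.ext (show y.1 = x.1 from hyx)]
    rw [map_cornerVal_B]
    change x.1 ∈ _
    rw [← (basis K n r).linearCombination_repr x.1, Finsupp.linearCombination_apply]
    refine Submodule.sum_mem _ fun c hc => Submodule.smul_mem _ _ (Submodule.subset_span ?_)
    obtain ⟨p, q, rfl⟩ := exists_orb c
    have h : row p x.1 q ≠ 0 := (Finsupp.mem_support_iff (f := (basis K n r).repr x.1)).1 hc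
    obtain ⟨σ, η, h1, -⟩ := orb_eq_iff.1 (orb_self_of_row_ne_zero_left (corner_left x) h)
    obtain ⟨ε, rfl⟩ := hx p q h
    simp only at h1
    -- As `p = iσ + nη`, the places of `ε` are permuted back by `σ⁻¹` when `p` is replaced by `i`.
    refine ⟨fun k => ε (σ⁻¹ k), congrArg (basis K n r) (orb_eq_iff.2 ⟨σ, η, h1, ?_⟩)⟩
    rw [← h1]
    funext k
    simp only [act, Equiv.Perm.inv_def, Equiv.symm_apply_apply]
    ring

theorem one_mem_B : (1 : CentralizerAlgebra K n i) ∈ B K n i := by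
  rw [mem_B_iff]
  -- The identity of the corner is `ξ_{i, i}`, the case `ε = 0`.
  have h := isDiagonal_xi_add_mul (K := K) (n := n) i 0
  simp only [Pi.zero_apply, mul_zero, add_zero] at h
  exact h

theorem mul_mem_B {x y : CentralizerAlgebra K n i} (hx : x ∈ B K n i) (hy : y ∈ B K n i) :
    x * y ∈ B K n i :=
  (mem_B_iff _).2 (((mem_B_iff x).1 hx).mul ((mem_B_iff y).1 hy))

/-- Any commutative subalgebra containing `B` centralizes `B`, so this gives maximality. -/
theorem mem_B_of_commute {x : CentralizerAlgebra K n i} (h : ∀ y ∈ B K n i, x * y = y * x) :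
    x ∈ B K n i :=
  (mem_B_iff x).2 <| isDiagonal_of_commute (corner_left x) (corner_right x) fun ε =>
    congrArg Subtype.val (h (xiShift K n i ε) (Submodule.subset_span ⟨ε, rfl⟩))

end AffineSchur

theorem propositionP (K : Type*) [Field K] [Infinite K] (n r : ℕ) [NeZero n]
    (i : Fin r → ℤ) (hi : ∀ k, 1 ≤ i k ∧ i k ≤ n) :
    ∃ A : Subalgebra K (AffineSchur.CentralizerAlgebra K n i),
      Subalgebra.toSubmodule A = AffineSchur.B K n i ∧
      Maximal (fun C : Subalgebra K (AffineSchur.CentralizerAlgebra K n i) =>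
        ∀ x ∈ C, ∀ y ∈ C, x * y = y * x) A := by
  refine ⟨(AffineSchur.B K n i).toSubalgebra AffineSchur.one_mem_B
    fun _ _ => AffineSchur.mul_mem_B, Submodule.toSubalgebra_toSubmodule _ _ _, ?_, ?_⟩
  · intro x hx y hy
    exact Subtype.ext
      (((AffineSchur.mem_B_iff x).1 hx).mul_comm ((AffineSchur.mem_B_iff y).1 hy))
  · intro C hC hle x hx
    exact AffineSchur.mem_B_of_commute fun y hy => hC x hx y (hle hy)
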